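/- Let $G$ be a finite connected directed graph (multiple edges allowed, no looped edges) with base vertex $x_0$, let $\pi=\pi_1(G,x_0)$ be its fundamental group (the group of homotopy classes of edge loops at $x_0$, written from left to right), and let $\widetilde G$ be its universal cover, on which $\pi$ acts on the left by covering transformations. Let $\mathcal T$ be a spanning tree of $G$, lifted to $\widetilde G$ starting at a chosen lift of $x_0$. This determines a lift $\widetilde V$ of every vertex $V$. For every edge $e$ let $\widetilde e$ be the lift of $e$ starting at the chosen lift of its initial vertex; for an interior point $x$ of $e$ let $\widetilde x$ be the point of $\widetilde e$ over $x$. For an edge $e$ let $\theta_e\in\pi$ be the class of the loop that goes through $\mathcal T$ from $x_0$ to the initial vertex of $e$, along $e$, and back through $\mathcal T$ to $x_0$; $\pi$ is free on the $\theta_e$ with $e\notin\mathcal T$. An *initial subword* of $w\in\pi$ is an element of $\pi$ represented by a (possibly empty or full) prefix of the reduced word of $w$ in these generators and their inverses. Let $f:G\to G$ be a continuous map that permutes the vertices and is homotopic to the identity, and let $\widetilde f:\widetilde G\to\widetilde G$ be a lift of $f$ that commutes with all covering transformations. If $k\ge 1$, $f^k(x)=x$ and $\widetilde f^k(\widetilde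 x)=w\widetilde x$ with $w\in\pi$, we say that $x$ is a periodic point with rotation element $w^{1/k}$ ($k$ need not be the least period). Let $E\in\mathcal T$ be an edge with initial vertex $V_1$ and terminal vertex $V_2$, and suppose that $V_1$ is periodic with $f^m(V_1)=V_1$ and rotation element $w_1^{1/m}$, and $V_2$ is periodic with $f^n(V_2)=V_2$ and rotation element $w_2^{1/n}$, where $m,n\ge 1$. Let $\widetilde P_i$ be the shortest edge path in $\widetilde G$ from $\widetilde V_i$ to $w_i\widetilde V_i$ ($i=1,2$). A path *begins with* $\widetilde E$ if its first edge is $\widetilde E$ or $\widetilde E^{-1}$. A cyclic reduction of $\alpha\in\pi$ is an edge loop (based at any vertex) freely homotopic to $\alpha$, without consecutive mutually inverse edges, whose first edge is not the inverse of its last edge; $E$ *belongs to* $\alpha$ if every cyclic reduction of $\alpha$ uses $E$ or $E^{-1}$. **Theorem.** Suppose that $E$ belongs to both $w_1$ and $w_2$, and that neither $\widetilde P_1$ nor $\widetilde P_2$ begins with $\widetilde E$. Then there exist an initial subword $\gamma_1$ of $w_1$ and an initial subword $\gamma_2$ of $w_2$ such that for all rationals $r,s$ with $0<r<1/m$ and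 $0<s<1/n$ there are integers $p,p'\ge 0$ and $q,q'\ge 1$ with $r=p/q$ and $s=p'/q'$, and periodic points in $E$ with rotation elements $(w_1^{p}\gamma_1)^{1/q}$ and $(w_2^{p'}\gamma_2)^{1/q'}$. -/

import Mathlib

/-- A directed graph with vertex set `V` and edge set `Ed`; multiple edges are allowed. -/
structure MDGraph (V Ed : Type*) where
  /-- initial vertex of an edge -/
  src : Ed → V
  /-- terminal vertex of an edge -/
  tgt : Ed → V

namespace MDGraph

section Basic

variable {V Ed : Type*} (G : MDGraph V Ed)

/-! ### Edge paths

An oriented edge is a pair `(e, b)`: `(e, true)` is `e` traversed forwards, `(e, false)` is `e⁻¹`.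
An edge path is the list of its oriented edges. -/

/-- The vertex where an oriented edge starts. -/
def stepSrc (s : Ed × Bool) : V := cond s.2 (G.src s.1) (G.tgt s.1)

/-- The vertex where an oriented edge ends. -/
def stepTgt (s : Ed × Bool) : V := cond s.2 (G.tgt s.1) (G.src s.1)

/-- `L` is an edge path from `a` to `b`. -/
def IsWalk : V → V → List (Ed × Bool) → Prop
  | a, b, [] => a = b
  | a, b, s :: L => G.stepSrc s = a ∧ IsWalk (G.stepTgt s) b L

/-- `L` is a shortest edge path from `a` to `b`. -/
def IsShortestWalk (a b : V) (L : List (Ed × Bool)) : Prop :=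
  G.IsWalk a b L ∧ ∀ L', G.IsWalk a b L' → L.length ≤ L'.length

/-- The first edge of the path `L` is `e` or `e⁻¹`. -/
def BeginsWith (L : List (Ed × Bool)) (e : Ed) : Prop := ∃ b : Bool, L.head? = some (e, b)

/-- `g` is the homotopy class of an edge path from `a` to `b` all of whose edges lie in `S`.
Two edge paths with the same endpoints are homotopic rel endpoints iff they become equal after
cancelling all pairs of consecutive mutually inverse edges, i.e. iff they define the same element
of the free group on the set of edges.  Concatenation of paths, read from left to right, is
multiplication. -/
def IsPathClassIn (S : Set Ed) (a b : V) (g : FreeGroup Ed) : Prop :=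
  ∃ L, G.IsWalk a b L ∧ (∀ s ∈ L, s.1 ∈ S) ∧ FreeGroup.mk L = g

/-- `g` is the homotopy class of an edge path from `a` to `b`. -/
def IsPathClass (a b : V) (g : FreeGroup Ed) : Prop :=
  ∃ L, G.IsWalk a b L ∧ FreeGroup.mk L = g

variable {G}

theorem IsWalk.append {a b c : V} {L M : List (Ed × Bool)} (h : G.IsWalk a b L)
    (h' : G.IsWalk b c M) : G.IsWalk a c (L ++ M) := by
  induction L generalizing a with
  | nil => cases h; exact h'
  | cons s L ih => exact ⟨h.1, ih h.2⟩

theorem IsWalk.invRev {a b : V} {L : List (Ed × Bool)} (h : G.IsWalk a b L) :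
    G.IsWalk b a (FreeGroup.invRev L) := by
  induction L generalizing a with
  | nil => cases h; exact rfl
  | cons s L ih =>
    obtain ⟨rfl, h2⟩ := h
    have h3 : FreeGroup.invRev (s :: L) = FreeGroup.invRev L ++ [(s.1, !s.2)] := by
      simp [FreeGroup.invRev]
    rw [h3]
    refine (ih h2).append ?_
    rcases s with ⟨e, _ | _⟩ <;> exact ⟨rfl, rfl⟩

theorem IsPathClass.mul {a b c : V} {g h : FreeGroup Ed} (hg : G.IsPathClass a b g)
    (hh : G.IsPathClass b c h) : G.IsPathClass a c (g * h) := by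
  obtain ⟨L, hL, rfl⟩ := hg
  obtain ⟨M, hM, rfl⟩ := hh
  exact ⟨L ++ M, hL.append hM, FreeGroup.mul_mk.symm⟩

theorem IsPathClass.inv {a b : V} {g : FreeGroup Ed} (hg : G.IsPathClass a b g) :
    G.IsPathClass b a g⁻¹ := by
  obtain ⟨L, hL, rfl⟩ := hg
  exact ⟨FreeGroup.invRev L, hL.invRev, FreeGroup.inv_mk.symm⟩

theorem isPathClass_one (a : V) : G.IsPathClass a a 1 := ⟨[], rfl, rfl⟩

theorem isPathClass_of (e : Ed) : G.IsPathClass (G.src e) (G.tgt e) (FreeGroup.of e) :=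
  ⟨[(e, true)], ⟨rfl, rfl⟩, rfl⟩

theorem IsPathClassIn.isPathClass {S : Set Ed} {a b : V} {g : FreeGroup Ed}
    (h : G.IsPathClassIn S a b g) : G.IsPathClass a b g := by
  obtain ⟨L, hL, -, hg⟩ := h
  exact ⟨L, hL, hg⟩

variable (G)

/-! ### Geometric realization -/

/-- A point for every vertex and a unit interval for every edge (topological disjoint union). -/
abbrev Cells (_G : MDGraph V Ed) : Type _ := (Σ _ : V, Unit) ⊕ (Σ _ : Ed, unitInterval)

/-- The endpoints of the interval of an edge are glued to the endpoints of the edge. -/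
inductive Glue : G.Cells → G.Cells → Prop
  | src (e : Ed) : Glue (Sum.inr ⟨e, 0⟩) (Sum.inl ⟨G.src e, ()⟩)
  | tgt (e : Ed) : Glue (Sum.inr ⟨e, 1⟩) (Sum.inl ⟨G.tgt e, ()⟩)

/-- The graph as a topological space, with the quotient topology. -/
def Realization : Type _ := Quot G.Glue

instance : TopologicalSpace G.Realization := inferInstanceAs (TopologicalSpace (Quot G.Glue))

/-- A vertex, as a point of the space. -/
def vertexPt (v : V) : G.Realization := Quot.mk _ (Sum.inl ⟨v, ()⟩)

/-- The point with parameter `t` of the edge `e`. -/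
def edgePt (e : Ed) (t : unitInterval) : G.Realization := Quot.mk _ (Sum.inr ⟨e, t⟩)

/-- A vertex map: the map permutes the vertices. -/
def IsVertexMap (f : C(G.Realization, G.Realization)) : Prop :=
  ∃ σ : Equiv.Perm V, ∀ v, f (G.vertexPt v) = G.vertexPt (σ v)

end Basic

/-- A morphism of directed graphs. -/
structure Hom {V Ed V' Ed' : Type*} (G : MDGraph V Ed) (H : MDGraph V' Ed') where
  onV : V → V'
  onE : Ed → Ed'
  src_onE : ∀ e, H.src (onE e) = onV (G.src e)
  tgt_onE : ∀ e, H.tgt (onE e) = onV (G.tgt e)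

/-- The map of spaces induced by a morphism, preserving the parameter on every edge. -/
def Hom.map {V Ed V' Ed' : Type*} {G : MDGraph V Ed} {H : MDGraph V' Ed'} (φ : Hom G H) :
    G.Realization → H.Realization :=
  Quot.lift
    (fun c => match c with
      | Sum.inl ⟨v, _⟩ => H.vertexPt (φ.onV v)
      | Sum.inr ⟨e, t⟩ => H.edgePt (φ.onE e) t)
    (by
      rintro _ _ (e | e)
      · show H.edgePt (φ.onE e) 0 = H.vertexPt (φ.onV (G.src e))
        rw [← φ.src_onE]
        exact Quot.sound (Glue.src _)
      · show H.edgePt (φ.onE e) 1 = H.vertexPt (φ.onV (G.tgt e))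
        rw [← φ.tgt_onE]
        exact Quot.sound (Glue.tgt _))

section Cover

variable {V Ed : Type*} (G : MDGraph V Ed) (x₀ : V)

/-- The fundamental group of the graph at `x₀`: homotopy classes of edge loops at `x₀`. -/
def fundGroup : Subgroup (FreeGroup Ed) where
  carrier := {g | G.IsPathClass x₀ x₀ g}
  mul_mem' := fun ha hb => ha.mul hb
  one_mem' := isPathClass_one x₀
  inv_mem' := fun ha => ha.inv

/-! ### The universal cover -/

/-- Vertices of the universal cover over `v`: homotopy classes of edge paths from `x₀` to `v`. -/
def CoverVertex : Type _ := {x : V × FreeGroup Ed // G.IsPathClass x₀ x.1 x.2}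

/-- Edges of the universal cover over `e`: homotopy classes of edge paths from `x₀` to the
initial vertex of `e`. -/
def CoverEdge : Type _ := {x : Ed × FreeGroup Ed // G.IsPathClass x₀ (G.src x.1) x.2}

/-- The universal cover: the edge `(e, g)` goes from `g` to the class of `g` followed by `e`. -/
def cover : MDGraph (G.CoverVertex x₀) (G.CoverEdge x₀) where
  src x := ⟨(G.src x.1.1, x.1.2), x.2⟩
  tgt x := ⟨(G.tgt x.1.1, x.1.2 * FreeGroup.of x.1.1), x.2.mul (isPathClass_of _)⟩

/-- The covering projection. -/
def coverProj : Hom (G.cover x₀) G where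
  onV x := x.1.1
  onE x := x.1.1
  src_onE _ := rfl
  tgt_onE _ := rfl

/-- The covering transformation of `w`: precede a path by the loop `w`. -/
def deck (w : G.fundGroup x₀) : Hom (G.cover x₀) (G.cover x₀) where
  onV x := ⟨(x.1.1, w.1 * x.1.2), IsPathClass.mul w.2 x.2⟩
  onE x := ⟨(x.1.1, w.1 * x.1.2), IsPathClass.mul w.2 x.2⟩
  src_onE _ := rfl
  tgt_onE _ := Subtype.ext (Prod.ext rfl (mul_assoc _ _ _))

instance : MulAction (G.fundGroup x₀) (G.CoverVertex x₀) where
  smul w x := (G.deck x₀ w).onV x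
  one_smul _ := Subtype.ext (Prod.ext rfl (one_mul _))
  mul_smul _ _ _ := Subtype.ext (Prod.ext rfl (mul_assoc _ _ _))

instance : MulAction (G.fundGroup x₀) (G.CoverEdge x₀) where
  smul w x := (G.deck x₀ w).onE x
  one_smul _ := Subtype.ext (Prod.ext rfl (one_mul _))
  mul_smul _ _ _ := Subtype.ext (Prod.ext rfl (mul_assoc _ _ _))

/-- The action of the fundamental group on the universal cover by covering transformations. -/
instance : MulAction (G.fundGroup x₀) (G.cover x₀).Realization where
  smul w := (G.deck x₀ w).map
  one_smul x := by
    induction x using Quot.ind with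
    | mk c =>
      rcases c with ⟨v, _⟩ | ⟨e, t⟩
      · exact congrArg (G.cover x₀).vertexPt (one_smul (G.fundGroup x₀) v)
      · exact congrArg (fun e => (G.cover x₀).edgePt e t) (one_smul (G.fundGroup x₀) e)
  mul_smul a b x := by
    induction x using Quot.ind with
    | mk c =>
      rcases c with ⟨v, _⟩ | ⟨e, t⟩
      · exact congrArg (G.cover x₀).vertexPt (mul_smul a b v)
      · exact congrArg (fun e => (G.cover x₀).edgePt e t) (mul_smul a b e)

/-- `F` is a lift of `f` to the universal cover that commutes with covering transformations. -/
def IsEquivariantLift (f : C(G.Realization, G.Realization))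
    (F : C((G.cover x₀).Realization, (G.cover x₀).Realization)) : Prop :=
  (∀ x, (G.coverProj x₀).map (F x) = f ((G.coverProj x₀).map x)) ∧
    ∀ (w : G.fundGroup x₀) x, F (w • x) = w • F x

/-! ### Belonging -/

/-- `L` is a cyclic reduction of the loop class `α`: an edge loop, at some vertex `u`, without
consecutive mutually inverse edges, whose first edge is not the inverse of its last edge, and which
is freely homotopic to `α`. -/
def IsCyclicReduction (α : G.fundGroup x₀) (L : List (Ed × Bool)) : Prop :=
  FreeGroup.IsCyclicallyReduced L ∧
    ∃ u h, G.IsWalk u u L ∧ G.IsPathClass x₀ u h ∧ (α : FreeGroup Ed) = h * FreeGroup.mk L * h⁻¹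

/-- The edge `e` belongs to `α`: every cyclic reduction of `α` uses `e` or `e⁻¹`. -/
def Belongs (e : Ed) (α : G.fundGroup x₀) : Prop :=
  ∀ L, G.IsCyclicReduction x₀ α L → ∃ b : Bool, (e, b) ∈ L

/-! ### Coherent labelings -/

/-- A spanning tree with root `x₀`: a set of edges in which every vertex is joined to the root by
exactly one edge path up to homotopy. -/
structure SpanningTree where
  edges : Set Ed
  existsUnique_path : ∀ v, ∃! g, G.IsPathClassIn edges x₀ v g

end Cover

namespace SpanningTree

variable {V Ed : Type*} {G : MDGraph V Ed} {x₀ : V} (T : G.SpanningTree x₀)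

/-- The class of the path in the tree from the root to `v`. -/
noncomputable def path (v : V) : FreeGroup Ed := (T.existsUnique_path v).choose

theorem path_spec (v : V) : G.IsPathClassIn T.edges x₀ v (T.path v) :=
  (T.existsUnique_path v).choose_spec.1

/-- The chosen lift of a vertex: the tree is lifted starting at the class of the constant path. -/
noncomputable def liftV (v : V) : G.CoverVertex x₀ :=
  ⟨(v, T.path v), (T.path_spec v).isPathClass⟩

/-- The chosen lift of an edge: the lift starting at the chosen lift of its initial vertex. -/
noncomputable def liftE (e : Ed) : G.CoverEdge x₀ :=
  ⟨(e, T.path (G.src e)), (T.path_spec (G.src e)).isPathClass⟩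

open Classical in
/-- The chosen lift of a point of the graph: a vertex is lifted to its chosen lift, an interior
point of an edge to the corresponding point of the chosen lift of the edge. -/
noncomputable def liftPt : G.Realization → (G.cover x₀).Realization :=
  Quot.lift
    (fun c => match c with
      | Sum.inl ⟨v, _⟩ => (G.cover x₀).vertexPt (T.liftV v)
      | Sum.inr ⟨e, t⟩ =>
        if t = 0 then (G.cover x₀).vertexPt (T.liftV (G.src e))
        else if t = 1 then (G.cover x₀).vertexPt (T.liftV (G.tgt e))
        else (G.cover x₀).edgePt (T.liftE e) t)
    (by rintro _ _ (e | e) <;> simp)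

/-- The loop class of `e`: through the tree to the initial vertex of `e`, along `e`, and back to the
root through the tree. For `e` outside the tree these are the standard free generators of the
fundamental group. -/
noncomputable def θ (e : Ed) : G.fundGroup x₀ :=
  ⟨T.path (G.src e) * FreeGroup.of e * (T.path (G.tgt e))⁻¹,
    ((T.path_spec _).isPathClass.mul (isPathClass_of e)).mul (T.path_spec _).isPathClass.inv⟩

/-- `γ` is an initial subword of `w`: a prefix of the reduced word representing `w` in the
generators `θ e` (`e` outside the tree) and their inverses. -/
def IsInitialWord (γ w : G.fundGroup x₀) : Prop :=
  ∃ C W : List ({e : Ed // e ∉ T.edges} × Bool), FreeGroup.IsReduced W ∧ C <+: W ∧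
    FreeGroup.lift (fun e : {e : Ed // e ∉ T.edges} => T.θ e.1) (FreeGroup.mk W) = w ∧
    FreeGroup.lift (fun e : {e : Ed // e ∉ T.edges} => T.θ e.1) (FreeGroup.mk C) = γ

/-- The point `x` is periodic with `f ^ n x = x` (`n` need not be the least period) and has rotation
element `w ^ (1 / n)` with respect to the lift `F`: the chosen lift of `x` is mapped by `F ^ n` to
its translate by `w`. -/
def HasRotationElement (f : C(G.Realization, G.Realization))
    (F : C((G.cover x₀).Realization, (G.cover x₀).Realization))
    (x : G.Realization) (w : G.fundGroup x₀) (n : ℕ) : Prop :=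
  0 < n ∧ f^[n] x = x ∧ F^[n] (T.liftPt x) = w • T.liftPt x

end SpanningTree

end MDGraph

/-!
The universal cover is a tree, and a translate `u Ẽ` of the chosen lift `Ẽ` of `E` cuts it into two
sides. If `F ^ q` maps the ends `Ṽ₁`, `Ṽ₂` of `Ẽ` to different sides of `u Ẽ`, then `F ^ q` maps some
point of `Ẽ` to the corresponding point of `u Ẽ`, which is a periodic point of `E` with rotation
element `u ^ (1 / q)`. To see this, use the signed distance from the initial vertex of `u Ẽ`
(`MDGraph.coverHeight`), a continuous function that takes values in `[0, 1]` only on `u Ẽ`, where it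
is the parameter: by the intermediate value theorem its value at the image of some point of `Ẽ` is
the parameter of that point (`MDGraph.SpanningTree.exists_hasRotationElement`).

So it suffices to know which edges the geodesic from `F ^ q Ṽ₁` to `F ^ q Ṽ₂` crosses. For
`q = m n d` it leads from `w₁ ^ k Ṽ₁` to `w₂ ^ l Ṽ₂` with `k = n d` and `l = m d`. As the paths from
`Ṽ₁` to `w₁ Ṽ₁` and from `Ṽ₂` to `w₂ Ṽ₂` do not begin with `Ẽ`, the geodesic is the path from
`w₁ ^ k Ṽ₁` back to `Ṽ₁`, then `Ẽ`, then the path from `Ṽ₂` to `w₂ ^ l Ṽ₂`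
(`FreeGroup.isReduced_invRev_pow_append_cons_pow`). The reduced path from `Ṽ₁` to `w₁ Ṽ₁` has the
form `A C A⁻¹` with `C` cyclically reduced, and the one to `w₁ ^ k Ṽ₁` is `A C ^ k A⁻¹`. Since `E`
belongs to `w₁`, it occurs in `C`, at a translate `γ₁ Ẽ`; the geodesic thus crosses `w₁ ^ p γ₁ Ẽ` for
all `p < k`, that is, for all `p` with `p / q < 1 / m`. Deleting the edges of the tree from the path
`A C A⁻¹` leaves the reduced word of `w₁` in the generators, and from the part before the edge
`γ₁ Ẽ` it leaves `γ₁`, which is therefore an initial subword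
(`MDGraph.SpanningTree.exists_isInitialWord_crossing`). The same holds for `w₂`.

Homotopy classes of edge paths are elements of the free group on the edges, so all geodesics are
reduced words in this free group.
-/

/-! ### Reduced words -/

namespace FreeGroup

variable {α : Type*} [DecidableEq α]

theorem toWord_mk_of_isReduced {L : List (α × Bool)} (h : IsReduced L) : (mk L).toWord = L := by
  rw [toWord_mk, h.reduce_eq]

theorem toWord_mul_of (x : FreeGroup α) (e : α) :
    (x * of e).toWord = x.toWord ++ [(e, true)] ∨ x.toWord = (x * of e).toWord ++ [(e, false)] := by
  have hx : IsReduced x.toWord := isReduced_toWord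
  have hm : x * of e = mk (x.toWord ++ [(e, true)]) := by
    rw [← mul_mk, mk_toWord]; rfl
  rcases List.eq_nil_or_concat x.toWord with h | ⟨L, s, h⟩
  · left
    rw [hm, h, toWord_mk_of_isReduced]
    exact IsReduced.singleton
  · rw [List.concat_eq_append] at h
    by_cases hs : s = (e, false)
    · right
      subst hs
      have : x * of e = mk L := by
        rw [hm, h, List.append_assoc, ← mul_mk]
        have : mk ([(e, false)] ++ [(e, true)]) = (1 : FreeGroup α) := by
          rw [← mul_mk]; exact inv_mul_cancel (of e)
        rw [this, mul_one]
      rw [this, toWord_mk_of_isReduced, h]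
      exact hx.infix ⟨[], [(e, false)], by simp [h]⟩
    · left
      rw [hm, toWord_mk_of_isReduced]
      rw [h, IsReduced, List.isChain_append]
      refine ⟨h ▸ hx, IsReduced.singleton, ?_⟩
      rintro a ha b hb hab
      obtain rfl : s = a := by simpa using ha
      obtain rfl : (e, true) = b := by simpa using hb
      by_contra hne
      exact hs (Prod.ext hab (by simpa using hne))

/-- Multiplication by a generator on the right changes whether the reduced word begins with the
letter `E` only along the edge from `1` to `E` of the Cayley tree. -/
theorem head?_toWord_mul_of {x : FreeGroup α} {E e : α} (h : ¬(x = 1 ∧ e = E)) :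
    (x * of e).toWord.head? = some (E, true) ↔ x.toWord.head? = some (E, true) := by
  rcases toWord_mul_of x e with h1 | h1
  · rw [h1]
    rcases hL : x.toWord with _ | ⟨s, L⟩
    · have : e ≠ E := fun he => h ⟨toWord_eq_nil_iff.1 hL, he⟩
      simp [this]
    · simp
  · rw [h1]
    rcases hL : (x * of e).toWord with _ | ⟨s, L⟩ <;> simp

theorem head?_toWord_pow (a : FreeGroup α) {k : ℕ} (hk : k ≠ 0) :
    (a ^ k).toWord.head? = a.toWord.head? := by
  rw [toWord_pow, reduceCyclically.reduce_flatten_replicate isReduced_toWord, if_neg hk]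
  conv_rhs => rw [← reduceCyclically.conj_conjugator_reduceCyclically a.toWord]
  rw [List.append_assoc, List.append_assoc, List.head?_append, List.head?_append,
    List.head?_append, List.head?_append]
  obtain ⟨k, rfl⟩ := Nat.exists_eq_succ_of_ne_zero hk
  rcases reduceCyclically a.toWord with _ | ⟨s, L⟩ <;> simp [List.replicate_succ]

/-- The word of the geodesic from `a ^ k` to `E * b ^ l` in the Cayley tree: back along the geodesic
from `1` to `a ^ k`, along the edge from `1` to `E`, and along the translate by `E` of the geodesic
from `1` to `b ^ l`. Neither of these two geodesics begins with the edge, so nothing cancels. -/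
theorem isReduced_invRev_pow_append_cons_pow {E : α} {a b : FreeGroup α}
    (ha : a.toWord.head? ≠ some (E, true)) (hb : b.toWord.head? ≠ some (E, false)) {k l : ℕ}
    (hk : k ≠ 0) (hl : l ≠ 0) :
    IsReduced (invRev (a ^ k).toWord ++ (E, true) :: (b ^ l).toWord) := by
  rw [← head?_toWord_pow a hk] at ha
  rw [← head?_toWord_pow b hl] at hb
  rw [← toWord_inv, IsReduced, List.isChain_append]
  refine ⟨isReduced_toWord, List.isChain_cons.2 ⟨?_, isReduced_toWord⟩, ?_⟩
  · rintro ⟨e, s⟩ hy (rfl : E = e)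
    cases s
    · exact absurd hy hb
    · rfl
  · rintro ⟨e, s⟩ hx y hy
    obtain rfl : (E, true) = y := by simpa using hy
    rintro (rfl : e = E)
    cases s
    · refine absurd ?_ ha
      rw [toWord_inv, invRev, List.getLast?_reverse, List.head?_map] at hx
      rcases hw : (a ^ k).toWord with _ | ⟨⟨e', s'⟩, R⟩
      · simp [hw] at hx
      · simp [hw] at hx
        simp [hx]
    · rfl

/-! ### Signed distance from an edge of the Cayley tree -/

/-- The signed distance from the vertex `1` of the Cayley tree to the vertex `x`, positive on the
side of the edge from `1` to `E` that contains `E`. -/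
def height (E : α) (x : FreeGroup α) : ℝ :=
  if x.toWord.head? = some (E, true) then norm x else -norm x

theorem one_le_height {E : α} {x : FreeGroup α} (h : x.toWord.head? = some (E, true)) :
    1 ≤ height E x := by
  rw [height, if_pos h, norm]
  rcases hL : x.toWord with _ | ⟨s, L⟩
  · simp [hL] at h
  · simp

theorem height_nonpos {E : α} {x : FreeGroup α} (h : x.toWord.head? ≠ some (E, true)) :
    height E x ≤ 0 := by
  rw [height, if_neg h]
  simp

@[simp] theorem height_one (E : α) : height E 1 = 0 := by simp [height]

@[simp] theorem height_of (E : α) : height E (of E) = 1 := by simp [height]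

theorem eq_one_of_height_eq_zero {E : α} {x : FreeGroup α} (h : height E x = 0) : x = 1 := by
  rw [height] at h
  split_ifs at h <;> simpa using h

theorem eq_of_of_height_eq_one {E : α} {x : FreeGroup α} (h : height E x = 1) : x = of E := by
  by_cases hx : x.toWord.head? = some (E, true)
  · rw [height, if_pos hx, norm] at h
    have h' : x.toWord.length = 1 := by exact_mod_cast h
    obtain ⟨s, hs⟩ := List.length_eq_one_iff.1 h'
    apply toWord_injective
    rw [hs] at hx ⊢
    simpa using hx
  · linarith [height_nonpos hx]

theorem eq_or_eq_of_height_mem_Icc {E : α} {x : FreeGroup α} (h0 : 0 ≤ height E x)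
    (h1 : height E x ≤ 1) : x = 1 ∨ x = of E := by
  by_cases hx : x.toWord.head? = some (E, true)
  · exact Or.inr (eq_of_of_height_eq_one (le_antisymm h1 (one_le_height hx)))
  · exact Or.inl (eq_one_of_height_eq_zero (le_antisymm (height_nonpos hx) h0))

/-- Suppose that the geodesic from `X` to `Y` in the Cayley tree crosses the edge from `z` to
`z * E`, in either direction. Then `X` and `Y` lie on different sides of that edge. -/
theorem height_separates {E : α} {X Y z : FreeGroup α} {s : Bool} {M N : List (α × Bool)}
    (h : IsReduced (M ++ (E, s) :: N)) (hXY : Y = X * mk (M ++ (E, s) :: N))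
    (hz : z * (if s then 1 else of E) = X * mk M) :
    (height E (z⁻¹ * X) ≤ 0 ∧ 1 ≤ height E (z⁻¹ * Y)) ∨
      (1 ≤ height E (z⁻¹ * X) ∧ height E (z⁻¹ * Y) ≤ 0) := by
  have hN : IsReduced ((E, s) :: N) := h.infix ⟨M, [], by simp⟩
  have hM : IsReduced (M ++ [(E, s)]) := h.infix ⟨[], N, by simp⟩
  have hinv : IsReduced (invRev M) := by
    have : IsReduced M := h.infix ⟨[], (E, s) :: N, by simp⟩
    rw [isReduced_iff_reduce_eq, reduce_invRev, this.reduce_eq]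
  have hinv' : IsReduced (invRev (M ++ [(E, s)])) := by
    rw [isReduced_iff_reduce_eq, reduce_invRev, hM.reduce_eq]
  rw [← mul_mk] at hXY
  cases s with
  | true =>
    left
    have hX : z⁻¹ * X = mk (invRev M) := by
      rw [← inv_mk, eq_inv_iff_mul_eq_one, mul_assoc, ← hz]; simp
    have hY : z⁻¹ * Y = mk ((E, true) :: N) := by
      rw [hXY, ← mul_assoc X, ← hz]; simp
    constructor
    · apply height_nonpos
      rw [hX, toWord_mk_of_isReduced hinv]
      intro hh
      -- otherwise `M` would end with the inverse of the letter `E` that follows it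
      rw [invRev_append] at hinv'
      obtain ⟨R, hR⟩ : ∃ R, M = R ++ [(E, false)] := by
        obtain ⟨R, hR⟩ := List.head?_eq_some_iff.1 hh
        refine ⟨invRev R, ?_⟩
        rw [← invRev_invRev (L₁ := M), hR, invRev_cons]
        rfl
      have := hM.infix (L₁ := [(E, false), (E, true)]) ⟨R, [], by simp [hR]⟩
      simp at this
    · apply one_le_height
      rw [hY, toWord_mk_of_isReduced hN]
      rfl
  | false =>
    right
    have hE : mk [(E, false)] = (of E)⁻¹ := rfl
    have hX : z⁻¹ * X = mk (invRev (M ++ [(E, false)])) := by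
      rw [← inv_mk, eq_inv_iff_mul_eq_one, mul_assoc, ← mul_mk, ← mul_assoc X, ← hz, hE]; simp
    have hY : z⁻¹ * Y = mk N := by
      have : mk ((E, false) :: N) = (of E)⁻¹ * mk N := by rw [← hE, mul_mk]; rfl
      rw [hXY, ← mul_assoc X, ← hz, this]; simp
    constructor
    · apply one_le_height
      rw [hX, toWord_mk_of_isReduced hinv', invRev_append]
      rfl
    · apply height_nonpos
      rw [hY, toWord_mk_of_isReduced (hN.infix ⟨[(E, false)], [], by simp⟩)]
      intro hh
      obtain ⟨R, rfl⟩ := List.head?_eq_some_iff.1 hh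
      simp at hN

end FreeGroup

namespace MDGraph

/-! ### Edge paths in a graph and in its universal cover -/

section Walks

variable {V Ed : Type*} {G : MDGraph V Ed}

theorem isWalk_append_iff {a c : V} {L M : List (Ed × Bool)} :
    G.IsWalk a c (L ++ M) ↔ ∃ b, G.IsWalk a b L ∧ G.IsWalk b c M := by
  refine ⟨fun h => ?_, fun ⟨b, h, h'⟩ => h.append h'⟩
  induction L generalizing a with
  | nil => exact ⟨a, rfl, h⟩
  | cons s L ih =>
    obtain ⟨b, h1, h2⟩ := ih h.2
    exact ⟨b, ⟨h.1, h1⟩, h2⟩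

theorem IsWalk.right_unique {a b b' : V} {L : List (Ed × Bool)} (h : G.IsWalk a b L)
    (h' : G.IsWalk a b' L) : b = b' := by
  induction L generalizing a with
  | nil => exact h.symm.trans h'
  | cons s L ih => exact ih h.2 h'.2

theorem stepTgt_not (e : Ed) (b : Bool) : G.stepTgt (e, !b) = G.stepSrc (e, b) := by
  cases b <;> rfl

theorem IsWalk.of_step {a b : V} {L M : List (Ed × Bool)} (h : G.IsWalk a b L)
    (hs : FreeGroup.Red.Step L M) : G.IsWalk a b M := by
  obtain @⟨L₁, L₂, e, s⟩ := hs
  obtain ⟨c, h1, h2, -, h3⟩ := isWalk_append_iff.1 h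
  rw [stepTgt_not, h2] at h3
  exact h1.append h3

theorem IsWalk.of_red {a b : V} {L M : List (Ed × Bool)} (h : G.IsWalk a b L)
    (hs : FreeGroup.Red L M) : G.IsWalk a b M := by
  induction hs with
  | refl => exact h
  | tail _ hs ih => exact ih.of_step hs

theorem IsPathClass.isWalk_toWord [DecidableEq Ed] {a b : V} {g : FreeGroup Ed}
    (h : G.IsPathClass a b g) : G.IsWalk a b g.toWord := by
  obtain ⟨L, hL, rfl⟩ := h
  exact hL.of_red (by rw [FreeGroup.toWord_mk]; exact FreeGroup.reduce.red)

theorem IsPathClass.right_unique {a b b' : V} {g : FreeGroup Ed} (h : G.IsPathClass a b g)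
    (h' : G.IsPathClass a b' g) : b = b' := by
  classical exact h.isWalk_toWord.right_unique h'.isWalk_toWord

end Walks

section CoverWalks

variable {V Ed : Type*} {G : MDGraph V Ed} {x₀ : V}

/-- A path in the universal cover from the class `x` to the class `y` projects to an edge path with
class `x⁻¹ * y`. -/
theorem mk_map_of_isWalk_cover {x y : G.CoverVertex x₀} {P : List (G.CoverEdge x₀ × Bool)}
    (h : (G.cover x₀).IsWalk x y P) :
    FreeGroup.mk (P.map fun s => (s.1.1.1, s.2)) = x.1.2⁻¹ * y.1.2 := by
  induction P generalizing x with
  | nil => obtain rfl : x = y := h; simp [FreeGroup.one_eq_mk]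
  | cons s P ih =>
    obtain ⟨rfl, h2⟩ := h
    rw [List.map_cons, ← List.singleton_append, ← FreeGroup.mul_mk, ih h2]
    rcases s with ⟨e, _ | _⟩
    · change (FreeGroup.of e.1.1)⁻¹ * (e.1.2⁻¹ * y.1.2) = (e.1.2 * FreeGroup.of e.1.1)⁻¹ * y.1.2
      group
    · change FreeGroup.of e.1.1 * ((e.1.2 * FreeGroup.of e.1.1)⁻¹ * y.1.2) = e.1.2⁻¹ * y.1.2
      group

/-- Edge paths lift to the universal cover. -/
theorem exists_isWalk_cover {a b : V} {L : List (Ed × Bool)} (hL : G.IsWalk a b L)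
    {g : FreeGroup Ed} (hg : G.IsPathClass x₀ a g) {y : G.CoverVertex x₀}
    (hy : y.1 = (b, g * FreeGroup.mk L)) :
    ∃ P, (G.cover x₀).IsWalk ⟨(a, g), hg⟩ y P ∧ P.length = L.length := by
  induction L generalizing a g with
  | nil =>
    obtain rfl : a = b := hL
    exact ⟨[], Subtype.ext (by rw [hy, ← FreeGroup.one_eq_mk, mul_one]), rfl⟩
  | cons s L ih =>
    obtain ⟨rfl, h2⟩ := hL
    rcases s with ⟨e, _ | _⟩
    · have hg' : G.IsPathClass x₀ (G.src e) (g * (FreeGroup.of e)⁻¹) :=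
        hg.mul (isPathClass_of e).inv
      obtain ⟨P, hP, hl⟩ := ih h2 hg' (by
        rw [hy, mul_assoc]; rfl)
      refine ⟨(⟨(e, g * (FreeGroup.of e)⁻¹), hg'⟩, false) :: P, ⟨Subtype.ext (Prod.ext rfl ?_), hP⟩,
        by simp [hl]⟩
      exact inv_mul_cancel_right _ _
    · obtain ⟨P, hP, hl⟩ := ih h2 (hg.mul (isPathClass_of e)) (by
        rw [hy, mul_assoc]; rfl)
      exact ⟨(⟨(e, g), hg⟩, true) :: P, ⟨rfl, hP⟩, by simp [hl]⟩

/-- A shortest path in the universal cover projects to a reduced word. -/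
theorem IsShortestWalk.map_eq_toWord [DecidableEq Ed] {x y : G.CoverVertex x₀}
    {P : List (G.CoverEdge x₀ × Bool)} (h : (G.cover x₀).IsShortestWalk x y P) :
    P.map (fun s => (s.1.1.1, s.2)) = (x.1.2⁻¹ * y.1.2).toWord := by
  have hmk := mk_map_of_isWalk_cover h.1
  have hred : FreeGroup.Red (P.map fun s => (s.1.1.1, s.2)) (x.1.2⁻¹ * y.1.2).toWord := by
    rw [← hmk, FreeGroup.toWord_mk]; exact FreeGroup.reduce.red
  obtain ⟨Q, hQ, hl⟩ := exists_isWalk_cover (x.2.inv.mul y.2).isWalk_toWord x.2 (y := y)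
    (by rw [FreeGroup.mk_toWord, mul_inv_cancel_left])
  refine (hred.sublist.eq_of_length_le ?_).symm
  simpa [hl] using h.2 Q hQ

end CoverWalks

/-! ### Initial subwords and crossings of the axis -/

namespace SpanningTree

variable {V Ed : Type*} {G : MDGraph V Ed} {x₀ : V} (T : G.SpanningTree x₀)

theorem path_mul {u v : V} {g : FreeGroup Ed} (h : G.IsPathClassIn T.edges u v g) :
    T.path u * g = T.path v := by
  obtain ⟨M, hM, hMT, rfl⟩ := h
  obtain ⟨L, hL, hLT, hLu⟩ := T.path_spec u
  refine (T.existsUnique_path v).unique ⟨L ++ M, hL.append hM, ?_, ?_⟩ (T.path_spec v)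
  · simp only [List.mem_append]
    rintro s (hs | hs)
    exacts [hLT s hs, hMT s hs]
  · rw [← FreeGroup.mul_mk, hLu]

theorem path_tgt {e : Ed} (he : e ∈ T.edges) :
    T.path (G.tgt e) = T.path (G.src e) * FreeGroup.of e :=
  (T.path_mul ⟨[(e, true)], ⟨rfl, rfl⟩, by simpa using he, rfl⟩).symm

theorem path_stepSrc {e : Ed} (he : e ∈ T.edges) (s : Bool) :
    T.path (G.stepSrc (e, s)) = T.path (G.src e) * (if s then 1 else FreeGroup.of e) := by
  cases s
  · exact T.path_tgt he
  · exact (mul_one _).symm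

open Classical in
/-- A letter of an edge path as a letter in the generators `θ e`, `e` outside the tree; the edges of
the tree disappear. -/
noncomputable def letter (s : Ed × Bool) : Option ({e : Ed // e ∉ T.edges} × Bool) :=
  if h : s.1 ∈ T.edges then none else some (⟨s.1, h⟩, s.2)

theorem letter_eq_none_iff {s : Ed × Bool} : T.letter s = none ↔ s.1 ∈ T.edges := by
  simp [letter]

theorem letter_eq_some {s : Ed × Bool} {y : {e : Ed // e ∉ T.edges} × Bool}
    (h : T.letter s = some y) : s = (y.1.1, y.2) := by
  unfold letter at h
  split_ifs at h
  rw [← Option.some.inj h]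

theorem θ_of_mem {e : Ed} (he : e ∈ T.edges) : T.θ e = 1 := by
  apply Subtype.ext
  change T.path (G.src e) * FreeGroup.of e * (T.path (G.tgt e))⁻¹ = 1
  rw [T.path_tgt he, mul_inv_cancel]

/-- The class of an edge path, closed up through the tree, is spelled by the edges of the path
outside the tree. -/
theorem lift_θ_mk_filterMap {u v : V} {L : List (Ed × Bool)} (h : G.IsWalk u v L) :
    ((FreeGroup.lift (fun e : {e : Ed // e ∉ T.edges} => T.θ e.1)
      (FreeGroup.mk (L.filterMap T.letter)) : G.fundGroup x₀) : FreeGroup Ed) =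
      T.path u * FreeGroup.mk L * (T.path v)⁻¹ := by
  induction L generalizing u with
  | nil => obtain rfl : u = v := h; simp [← FreeGroup.one_eq_mk]
  | cons s L ih =>
    obtain ⟨rfl, h2⟩ := h
    have key : T.path (G.stepSrc s) * FreeGroup.mk (s :: L) * (T.path v)⁻¹ =
        ((cond s.2 (T.θ s.1) (T.θ s.1)⁻¹ : G.fundGroup x₀) : FreeGroup Ed) *
          (T.path (G.stepTgt s) * FreeGroup.mk L * (T.path v)⁻¹) := by
      rw [← List.singleton_append, ← FreeGroup.mul_mk]
      rcases s with ⟨e, _ | _⟩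
      · change T.path (G.tgt e) * ((FreeGroup.of e)⁻¹ * _) * _ =
          (T.path (G.src e) * FreeGroup.of e * (T.path (G.tgt e))⁻¹)⁻¹ * (T.path (G.src e) * _ * _)
        group
      · change T.path (G.src e) * (FreeGroup.of e * _) * _ =
          (T.path (G.src e) * FreeGroup.of e * (T.path (G.tgt e))⁻¹) * (T.path (G.tgt e) * _ * _)
        group
    rw [key, ← ih h2]
    by_cases hs : s.1 ∈ T.edges
    · rw [List.filterMap_cons_none (T.letter_eq_none_iff.2 hs), T.θ_of_mem hs]
      cases s.2 <;> simp
    · rw [List.filterMap_cons_some (b := (⟨s.1, hs⟩, s.2)) (by simp [letter, hs]),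
        ← List.singleton_append, ← FreeGroup.mul_mk, map_mul]
      simp

/-- Deleting the edges of the tree from a reduced edge path leaves a reduced word: a closed reduced
edge path in the tree is constant, so no new cancellation arises. -/
theorem isReduced_filterMap {u v : V} {L : List (Ed × Bool)} (h : G.IsWalk u v L)
    (hL : FreeGroup.IsReduced L) : FreeGroup.IsReduced (L.filterMap T.letter) := by
  induction L generalizing u with
  | nil => exact FreeGroup.IsReduced.nil
  | cons s L ih =>
    have ih' := ih h.2 (hL.infix ⟨[s], [], by simp⟩)
    by_cases hs : s.1 ∈ T.edges
    · rwa [List.filterMap_cons_none (T.letter_eq_none_iff.2 hs)]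
    · rw [List.filterMap_cons_some (b := (⟨s.1, hs⟩, s.2)) (by simp [letter, hs])]
      refine List.isChain_cons.2 ⟨?_, ih'⟩
      rintro y hy hye
      obtain ⟨R, hR⟩ := List.head?_eq_some_iff.1 hy
      obtain ⟨M, s', N, rfl, hM, hs', -⟩ := List.filterMap_eq_cons_iff.1 hR
      obtain rfl := T.letter_eq_some hs'
      obtain ⟨c, hMw, hsrc, -⟩ := isWalk_append_iff.1 h.2
      by_contra hne
      have hsy : s = (y.1.1, !y.2) := Prod.ext (congrArg Subtype.val hye) (Bool.eq_not.2 hne)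
      -- the part of the path between `s` and its inverse is a closed path in the tree
      obtain rfl : G.stepTgt s = c := by rw [hsy, stepTgt_not, hsrc]
      have hred : FreeGroup.IsReduced M := hL.infix ⟨[s], (y.1.1, y.2) :: N, by simp⟩
      have hM1 : FreeGroup.mk M = 1 := by
        have := T.path_mul ⟨M, hMw, fun x hx => T.letter_eq_none_iff.1 (hM x hx), rfl⟩
        simpa using this
      have hM0 : M = [] := by
        classical
        rw [← FreeGroup.toWord_mk_of_isReduced hred, hM1, FreeGroup.toWord_one]
      subst hM0
      subst hsy
      simp at hL

/-- A prefix of the reduced edge path from the chosen lift of `v` to its translate by `w`, closed up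
through the tree, is an initial subword of `w`. -/
theorem isInitialWord_of_toWord_eq_append [DecidableEq Ed] {v u : V} {w γ : G.fundGroup x₀}
    {A B : List (Ed × Bool)}
    (hAB : ((T.path v)⁻¹ * w * T.path v : FreeGroup Ed).toWord = A ++ B)
    (hA : G.IsWalk v u A)
    (hγ : (γ : FreeGroup Ed) = T.path v * FreeGroup.mk A * (T.path u)⁻¹) :
    T.IsInitialWord γ w := by
  have hv := (T.path_spec v).isPathClass
  have hw : G.IsWalk v v ((T.path v)⁻¹ * w * T.path v : FreeGroup Ed).toWord :=
    ((hv.inv.mul w.2).mul hv).isWalk_toWord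
  refine ⟨A.filterMap T.letter, (A ++ B).filterMap T.letter, ?_, ?_, ?_, ?_⟩
  · rw [← hAB]
    exact T.isReduced_filterMap hw FreeGroup.isReduced_toWord
  · rw [List.filterMap_append]
    exact List.prefix_append _ _
  · apply Subtype.ext
    rw [← hAB, T.lift_θ_mk_filterMap hw, FreeGroup.mk_toWord]
    group
  · apply Subtype.ext
    rw [T.lift_θ_mk_filterMap hA, hγ]

/-- If the tree edge `E` belongs to `w`, then the axis of `w` contains a translate `γ Ẽ` with `γ` an
initial subword of `w`, and the geodesic from the chosen lift of `v` to its translate by `w ^ k`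
crosses `w ^ p γ Ẽ` for all `p < k`. -/
theorem exists_isInitialWord_crossing [DecidableEq Ed] {E : Ed} (hE : E ∈ T.edges) (v : V)
    {w : G.fundGroup x₀} (hw : G.Belongs x₀ E w) :
    ∃ γ, T.IsInitialWord γ w ∧ ∀ p k : ℕ, p < k → ∃ s M N,
      (((T.path v)⁻¹ * w * T.path v : FreeGroup Ed) ^ k).toWord = M ++ (E, s) :: N ∧
      ((w ^ p * γ : G.fundGroup x₀) : FreeGroup Ed) * T.path (G.src E) *
        (if s then 1 else FreeGroup.of E) = T.path v * FreeGroup.mk M := by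
  set a : FreeGroup Ed := (T.path v)⁻¹ * w * T.path v with ha
  have hv := (T.path_spec v).isPathClass
  have haw : G.IsWalk v v a.toWord := ((hv.inv.mul w.2).mul hv).isWalk_toWord
  have hconj := FreeGroup.reduceCyclically.conj_conjugator_reduceCyclically a.toWord
  have hcyc := FreeGroup.reduceCyclically.isCyclicallyReduced (FreeGroup.isReduced_toWord (x := a))
  have hpow := FreeGroup.reduceCyclically.reduce_flatten_replicate
    (FreeGroup.isReduced_toWord (x := a))
  set A := FreeGroup.reduceCyclically.conjugator a.toWord
  set C := FreeGroup.reduceCyclically a.toWord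
  rw [← hconj, isWalk_append_iff] at haw
  obtain ⟨u', hAC, hA'⟩ := haw
  obtain ⟨u, hA, hC⟩ := isWalk_append_iff.1 hAC
  obtain rfl : u' = u := by
    have := hA'.invRev
    rw [FreeGroup.invRev_invRev] at this
    exact this.right_unique hA
  have haAC : a = FreeGroup.mk A * FreeGroup.mk C * (FreeGroup.mk A)⁻¹ := by
    rw [FreeGroup.inv_mk, FreeGroup.mul_mk, FreeGroup.mul_mk, hconj, FreeGroup.mk_toWord]
  obtain ⟨s, hs⟩ := hw C ⟨hcyc, u', T.path v * FreeGroup.mk A, hC, hv.mul ⟨A, hA, rfl⟩, by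
    have : (w : FreeGroup Ed) = T.path v * a * (T.path v)⁻¹ := by rw [ha]; group
    rw [this, haAC]; group⟩
  obtain ⟨C₁, C₂, hC12⟩ := List.append_of_mem hs
  have hAC1 : G.IsWalk v (G.stepSrc (E, s)) (A ++ C₁) := by
    rw [hC12] at hC
    obtain ⟨c, hC1, hc, -⟩ := isWalk_append_iff.1 hC
    exact hA.append (hc ▸ hC1)
  obtain ⟨γ, hγ⟩ : ∃ γ : G.fundGroup x₀,
      (γ : FreeGroup Ed) = T.path v * FreeGroup.mk (A ++ C₁) * (T.path (G.stepSrc (E, s)))⁻¹ :=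
    ⟨⟨_, (hv.mul ⟨_, hAC1, rfl⟩).mul (T.path_spec _).isPathClass.inv⟩, rfl⟩
  refine ⟨γ, T.isInitialWord_of_toWord_eq_append (B := (E, s) :: C₂ ++ FreeGroup.invRev A) ?_ hAC1 hγ, ?_⟩
  · rw [← ha, ← hconj, hC12]
    simp
  · intro p k hpk
    obtain ⟨d, rfl⟩ := Nat.exists_eq_add_of_lt hpk
    refine ⟨s, A ++ (List.replicate p C).flatten ++ C₁,
      C₂ ++ (List.replicate d C).flatten ++ FreeGroup.invRev A, ?_, ?_⟩
    · rw [FreeGroup.toWord_pow, hpow, if_neg (by omega), add_assoc, add_comm d,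
        List.replicate_add, List.replicate_add]
      simp [hC12]
    · have hap : a ^ p = FreeGroup.mk A * FreeGroup.mk C ^ p * (FreeGroup.mk A)⁻¹ := by
        rw [haAC, conj_pow]
      have hwp : (w : FreeGroup Ed) ^ p = T.path v * a ^ p * (T.path v)⁻¹ := by
        rw [← conj_pow, ha]; congr 1; group
      rw [mul_assoc, ← T.path_stepSrc hE, Subgroup.coe_mul, Subgroup.coe_pow, hwp, hap, hγ,
        FreeGroup.pow_mk, ← FreeGroup.mul_mk, ← FreeGroup.mul_mk, ← FreeGroup.mul_mk]
      group

end SpanningTree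

/-! ### The height function on the universal cover -/

section Points

variable {V Ed : Type*} (G : MDGraph V Ed)

theorem continuous_edgePt (e : Ed) : Continuous (G.edgePt e) :=
  continuous_quot_mk.comp (continuous_inr.comp continuous_sigmaMk)

theorem edgePt_zero (e : Ed) : G.edgePt e 0 = G.vertexPt (G.src e) := Quot.sound (Glue.src e)

theorem edgePt_one (e : Ed) : G.edgePt e 1 = G.vertexPt (G.tgt e) := Quot.sound (Glue.tgt e)

end Points

section Height

variable {V Ed : Type*} [DecidableEq Ed] (G : MDGraph V Ed) (x₀ : V)

/-- The signed distance in the universal cover from the initial vertex `z` of the lift `(E, z)` of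
the edge `E`, positive on the side of that edge that contains its terminal vertex. It is given on
vertices by the word length and is affine on every edge; on the edge `(E, z)` itself it is the
parameter. -/
noncomputable def coverHeight (E : Ed) (z : FreeGroup Ed) : (G.cover x₀).Realization → ℝ :=
  Quot.lift
    (fun c => match c with
      | Sum.inl ⟨x, _⟩ => FreeGroup.height E (z⁻¹ * x.1.2)
      | Sum.inr ⟨e, t⟩ => (1 - (t : ℝ)) * FreeGroup.height E (z⁻¹ * e.1.2) +
          t * FreeGroup.height E (z⁻¹ * e.1.2 * FreeGroup.of e.1.1))
    (by
      rintro _ _ (e | e)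
      · simp [cover]
      · simp [cover, mul_assoc])

theorem continuous_coverHeight (E : Ed) (z : FreeGroup Ed) :
    Continuous (G.coverHeight x₀ E z) := by
  refine continuous_quot_lift _ ?_
  refine continuous_sum_dom.2 ⟨continuous_sigma fun x => ?_, continuous_sigma fun e => ?_⟩
  · exact continuous_const
  · change Continuous fun t : unitInterval => (1 - (t : ℝ)) * FreeGroup.height E (z⁻¹ * e.1.2) +
          t * FreeGroup.height E (z⁻¹ * e.1.2 * FreeGroup.of e.1.1)
    fun_prop

/-- The height takes values in `[0, 1]` only on the edge `(E, z)`. -/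
theorem eq_edgePt_of_coverHeight_eq {E : Ed} {z : FreeGroup Ed}
    (hz : G.IsPathClass x₀ (G.src E) z) {y : (G.cover x₀).Realization} {t : unitInterval}
    (hy : G.coverHeight x₀ E z y = t) : y = (G.cover x₀).edgePt ⟨(E, z), hz⟩ t := by
  have hvertex : ∀ x : G.CoverVertex x₀, FreeGroup.height E (z⁻¹ * x.1.2) = t →
      (G.cover x₀).vertexPt x = (G.cover x₀).edgePt ⟨(E, z), hz⟩ t := by
    intro x hx
    rcases FreeGroup.eq_or_eq_of_height_mem_Icc (hx ▸ t.2.1) (hx ▸ t.2.2) with h | h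
    · rw [h, FreeGroup.height_one] at hx
      obtain rfl : t = 0 := Subtype.ext hx.symm
      rw [inv_mul_eq_one] at h
      refine Eq.trans ?_ ((G.cover x₀).edgePt_zero _).symm
      exact congrArg _ (Subtype.ext (Prod.ext (x.2.right_unique (h ▸ hz)) h.symm))
    · rw [h, FreeGroup.height_of] at hx
      obtain rfl : t = 1 := Subtype.ext hx.symm
      rw [inv_mul_eq_iff_eq_mul] at h
      refine Eq.trans ?_ ((G.cover x₀).edgePt_one _).symm
      exact congrArg _ (Subtype.ext
        (Prod.ext (x.2.right_unique (h ▸ hz.mul (isPathClass_of E))) h))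
  induction y using Quot.ind with
  | mk c =>
    rcases c with ⟨x, _⟩ | ⟨e, s⟩
    · exact hvertex x hy
    · change (1 - (s : ℝ)) * FreeGroup.height E (z⁻¹ * e.1.2) +
          s * FreeGroup.height E (z⁻¹ * e.1.2 * FreeGroup.of e.1.1) = t at hy
      change (G.cover x₀).edgePt e s = _
      by_cases he : z⁻¹ * e.1.2 = 1 ∧ e.1.1 = E
      · rw [he.1, he.2, one_mul, FreeGroup.height_one, FreeGroup.height_of] at hy
        obtain rfl : s = t := Subtype.ext (by linarith)
        exact congrArg (fun e => (G.cover x₀).edgePt e s)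
          (Subtype.ext (Prod.ext he.2 (inv_mul_eq_one.1 he.1).symm))
      have hsides := FreeGroup.head?_toWord_mul_of he
      rcases eq_or_ne s 0 with rfl | hs0
      · rw [edgePt_zero]
        exact hvertex _ (by simpa [cover] using hy)
      rcases eq_or_ne s 1 with rfl | hs1
      · rw [edgePt_one]
        exact hvertex _ (by simpa [cover, mul_assoc] using hy)
      have hs0' : 0 < (s : ℝ) := lt_of_le_of_ne s.2.1 fun h => hs0 (Subtype.ext h.symm)
      have hs1' : 0 < 1 - (s : ℝ) := sub_pos.2 (lt_of_le_of_ne s.2.2 fun h => hs1 (Subtype.ext h))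
      have ht0 := t.2.1
      have ht1 := t.2.2
      exfalso
      -- both ends of any other edge are on the same side, and they cannot both be at the same end
      -- of the edge `(E, z)`
      have hne : z⁻¹ * e.1.2 ≠ z⁻¹ * e.1.2 * FreeGroup.of e.1.1 := by simp
      by_cases hh : (z⁻¹ * e.1.2).toWord.head? = some (E, true)
      · have h1 := FreeGroup.one_le_height hh
        have h2 := FreeGroup.one_le_height (hsides.2 hh)
        have h1' := mul_nonneg hs1'.le (sub_nonneg.2 h1)
        have h2' := mul_nonneg hs0'.le (sub_nonneg.2 h2)
        have h3 := (mul_eq_zero.1 (le_antisymm (by linarith) h1')).resolve_left hs1'.ne'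
        have h4 := (mul_eq_zero.1 (le_antisymm (by linarith) h2')).resolve_left hs0'.ne'
        exact hne ((FreeGroup.eq_of_of_height_eq_one (sub_eq_zero.1 h3)).trans
          (FreeGroup.eq_of_of_height_eq_one (sub_eq_zero.1 h4)).symm)
      · have h1 := FreeGroup.height_nonpos hh
        have h2 := FreeGroup.height_nonpos (fun h => hh (hsides.1 h))
        have h1' := mul_nonpos_of_nonneg_of_nonpos hs1'.le h1
        have h2' := mul_nonpos_of_nonneg_of_nonpos hs0'.le h2
        have h3 := (mul_eq_zero.1 (le_antisymm h1' (by linarith))).resolve_left hs1'.ne'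
        have h4 := (mul_eq_zero.1 (le_antisymm h2' (by linarith))).resolve_left hs0'.ne'
        exact hne ((FreeGroup.eq_one_of_height_eq_zero h3).trans
          (FreeGroup.eq_one_of_height_eq_zero h4).symm)

end Height

/-! ### Fixed points of translates of iterates -/

namespace IsEquivariantLift

variable {V Ed : Type*} {G : MDGraph V Ed} {x₀ : V} {f : C(G.Realization, G.Realization)}
  {F : C((G.cover x₀).Realization, (G.cover x₀).Realization)}

theorem map_iterate (hF : G.IsEquivariantLift x₀ f F) (q : ℕ) (x : (G.cover x₀).Realization) :
    (G.coverProj x₀).map (F^[q] x) = f^[q] ((G.coverProj x₀).map x) :=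
  Function.Semiconj.iterate_right (f := (G.coverProj x₀).map) (ga := F) (gb := f) hF.1 q x

theorem iterate_mul (hF : G.IsEquivariantLift x₀ f F) {m : ℕ} {w : G.fundGroup x₀}
    {x : (G.cover x₀).Realization} (hx : F^[m] x = w • x) (k : ℕ) :
    F^[m * k] x = w ^ k • x := by
  induction k with
  | zero => simp
  | succ k ih =>
    have hcomm : F^[m] (w ^ k • x) = w ^ k • F^[m] x :=
      (Function.Semiconj.iterate_right (f := fun y => w ^ k • y) (ga := F) (gb := F)
        (fun y => (hF.2 _ y).symm) m x).symm
    rw [Nat.mul_succ, add_comm, Function.iterate_add_apply, ih, hcomm, hx, pow_succ, mul_smul]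

end IsEquivariantLift

namespace SpanningTree

variable {V Ed : Type*} {G : MDGraph V Ed} {x₀ : V} (T : G.SpanningTree x₀)

theorem liftPt_edgePt {e : Ed} (he : e ∈ T.edges) (t : unitInterval) :
    T.liftPt (G.edgePt e t) = (G.cover x₀).edgePt (T.liftE e) t := by
  change (if t = 0 then (G.cover x₀).vertexPt (T.liftV (G.src e))
        else if t = 1 then (G.cover x₀).vertexPt (T.liftV (G.tgt e))
        else (G.cover x₀).edgePt (T.liftE e) t) = _
  split_ifs with h0 h1
  · rw [h0, edgePt_zero]; rfl
  · rw [h1, edgePt_one]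
    exact congrArg _ (Subtype.ext (Prod.ext rfl (T.path_tgt he)))
  · rfl

/-- If the images under `F ^ q` of the ends of `Ẽ` lie on different sides of `u Ẽ`, then some point
of `E` has rotation element `u ^ (1 / q)`: by the intermediate value theorem, the height with
respect to `u Ẽ` of the image of a point of `Ẽ` agrees somewhere with the parameter of the point. -/
theorem exists_hasRotationElement [DecidableEq Ed] {f : C(G.Realization, G.Realization)}
    {F : C((G.cover x₀).Realization, (G.cover x₀).Realization)} (hF : G.IsEquivariantLift x₀ f F)
    {E : Ed} (hE : E ∈ T.edges) {q : ℕ} (hq : 0 < q) (u : G.fundGroup x₀) {X Y : G.CoverVertex x₀}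
    (hX : F^[q] ((G.cover x₀).vertexPt (T.liftV (G.src E))) = (G.cover x₀).vertexPt X)
    (hY : F^[q] ((G.cover x₀).vertexPt (T.liftV (G.tgt E))) = (G.cover x₀).vertexPt Y)
    (h : (FreeGroup.height E ((u * T.path (G.src E))⁻¹ * X.1.2) ≤ 0 ∧
        1 ≤ FreeGroup.height E ((u * T.path (G.src E))⁻¹ * Y.1.2)) ∨
      (1 ≤ FreeGroup.height E ((u * T.path (G.src E))⁻¹ * X.1.2) ∧
        FreeGroup.height E ((u * T.path (G.src E))⁻¹ * Y.1.2) ≤ 0)) :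
    ∃ t : unitInterval, T.HasRotationElement f F (G.edgePt E t) u q := by
  let ψ : unitInterval → ℝ := fun t => G.coverHeight x₀ E (u * T.path (G.src E))
    (F^[q] ((G.cover x₀).edgePt (T.liftE E) t)) - t
  have hψ : Continuous ψ := ((G.continuous_coverHeight x₀ E _).comp
    ((F.continuous.iterate q).comp ((G.cover x₀).continuous_edgePt _))).sub continuous_subtype_val
  have hψ0 : ψ 0 = FreeGroup.height E ((u * T.path (G.src E))⁻¹ * X.1.2) := by
    have : F^[q] ((G.cover x₀).edgePt (T.liftE E) 0) = (G.cover x₀).vertexPt X := by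
      rw [edgePt_zero]; exact hX
    simp only [ψ, this, Set.Icc.coe_zero, sub_zero]
    rfl
  have hψ1 : ψ 1 = FreeGroup.height E ((u * T.path (G.src E))⁻¹ * Y.1.2) - 1 := by
    have : F^[q] ((G.cover x₀).edgePt (T.liftE E) 1) = (G.cover x₀).vertexPt Y := by
      rw [← hY, ← T.liftPt_edgePt hE, edgePt_one]; rfl
    simp only [ψ, this, Set.Icc.coe_one]
    rfl
  obtain ⟨t, ht⟩ : ∃ t, ψ t = 0 := by
    rcases h with ⟨h0, h1⟩ | ⟨h0, h1⟩
    · exact mem_range_of_exists_le_of_exists_ge hψ ⟨0, by linarith⟩ ⟨1, by linarith⟩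
    · exact mem_range_of_exists_le_of_exists_ge hψ ⟨1, by linarith⟩ ⟨0, by linarith⟩
  have hfix : F^[q] (T.liftPt (G.edgePt E t)) = u • T.liftPt (G.edgePt E t) := by
    rw [T.liftPt_edgePt hE]
    exact G.eq_edgePt_of_coverHeight_eq x₀ (u.2.mul (T.path_spec _).isPathClass) (sub_eq_zero.1 ht)
  refine ⟨t, hq, ?_, hfix⟩
  have hproj := hF.map_iterate q (T.liftPt (G.edgePt E t))
  rw [hfix, T.liftPt_edgePt hE] at hproj
  exact hproj.symm

end SpanningTree

end MDGraph

/-! ### Periodic points in the edge -/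

theorem mainTheorem4 {V Ed : Type*} [Finite V] [Finite Ed] (G : MDGraph V Ed)
    (hG : ∀ e, G.src e ≠ G.tgt e) (x₀ : V) (T : G.SpanningTree x₀)
    (f : C(G.Realization, G.Realization)) (hf : G.IsVertexMap f)
    (hid : f.Homotopic (ContinuousMap.id G.Realization))
    (F : C((G.cover x₀).Realization, (G.cover x₀).Realization))
    (hF : G.IsEquivariantLift x₀ f F)
    (E : Ed) (hE : E ∈ T.edges)
    (m n : ℕ) (w₁ w₂ : G.fundGroup x₀)
    (hw₁ : T.HasRotationElement f F (G.vertexPt (G.src E)) w₁ m)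
    (hw₂ : T.HasRotationElement f F (G.vertexPt (G.tgt E)) w₂ n)
    (hE₁ : G.Belongs x₀ E w₁) (hE₂ : G.Belongs x₀ E w₂)
    (P₁ P₂ : List (G.CoverEdge x₀ × Bool))
    (hP₁ : (G.cover x₀).IsShortestWalk (T.liftV (G.src E)) (w₁ • T.liftV (G.src E)) P₁)
    (hP₂ : (G.cover x₀).IsShortestWalk (T.liftV (G.tgt E)) (w₂ • T.liftV (G.tgt E)) P₂)
    (hPE₁ : ¬ MDGraph.BeginsWith P₁ (T.liftE E)) (hPE₂ : ¬ MDGraph.BeginsWith P₂ (T.liftE E)) :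
    ∃ γ₁ γ₂ : G.fundGroup x₀, T.IsInitialWord γ₁ w₁ ∧ T.IsInitialWord γ₂ w₂ ∧
      ∀ r s : ℚ, 0 < r → r < 1 / m → 0 < s → s < 1 / n →
        ∃ p q p' q' : ℕ, 0 < q ∧ 0 < q' ∧ r = p / q ∧ s = p' / q' ∧
          (∃ t : unitInterval, T.HasRotationElement f F (G.edgePt E t) (w₁ ^ p * γ₁) q) ∧
          (∃ t : unitInterval, T.HasRotationElement f F (G.edgePt E t) (w₂ ^ p' * γ₂) q') := by
  classical
  set a : FreeGroup Ed := (T.path (G.src E))⁻¹ * w₁ * T.path (G.src E) with ha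
  set b : FreeGroup Ed := (T.path (G.tgt E))⁻¹ * w₂ * T.path (G.tgt E) with hb
  have ha0 : a.toWord.head? ≠ some (E, true) := by
    intro h
    have hPa := hP₁.map_eq_toWord
    rw [show (T.liftV (G.src E)).1.2⁻¹ * (w₁ • T.liftV (G.src E)).1.2 = a from
      (mul_assoc _ _ _).symm] at hPa
    rw [← hPa, List.head?_map, Option.map_eq_some_iff] at h
    obtain ⟨⟨e, s⟩, hs, hes⟩ := h
    obtain ⟨rfl, rfl⟩ := Prod.mk.inj hes
    refine hPE₁ ⟨true, ?_⟩
    obtain ⟨R, rfl⟩ := List.head?_eq_some_iff.1 hs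
    have hsrc : (G.cover x₀).src e = T.liftV (G.src e.1.1) := hP₁.1.1
    have hsrc' : e.1.2 = T.path (G.src e.1.1) := congrArg (fun x => x.1.2) hsrc
    rw [hs, show e = T.liftE e.1.1 from Subtype.ext (Prod.ext rfl hsrc')]
    rfl
  have hb0 : b.toWord.head? ≠ some (E, false) := by
    intro h
    have hPb := hP₂.map_eq_toWord
    rw [show (T.liftV (G.tgt E)).1.2⁻¹ * (w₂ • T.liftV (G.tgt E)).1.2 = b from
      (mul_assoc _ _ _).symm] at hPb
    rw [← hPb, List.head?_map, Option.map_eq_some_iff] at h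
    obtain ⟨⟨e, s⟩, hs, hes⟩ := h
    obtain ⟨rfl, rfl⟩ := Prod.mk.inj hes
    refine hPE₂ ⟨false, ?_⟩
    obtain ⟨R, rfl⟩ := List.head?_eq_some_iff.1 hs
    have htgt : (G.cover x₀).tgt e = T.liftV (G.tgt e.1.1) := hP₂.1.1
    have htgt' : e.1.2 * FreeGroup.of e.1.1 = T.path (G.tgt e.1.1) :=
      congrArg (fun x => x.1.2) htgt
    rw [T.path_tgt hE, mul_left_inj] at htgt'
    rw [hs, show e = T.liftE e.1.1 from Subtype.ext (Prod.ext rfl htgt')]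
    rfl
  obtain ⟨γ₁, hγ₁, hcross₁⟩ := T.exists_isInitialWord_crossing hE (G.src E) hE₁
  obtain ⟨γ₂, hγ₂, hcross₂⟩ := T.exists_isInitialWord_crossing hE (G.tgt E) hE₂
  rw [← ha] at hcross₁
  rw [← hb] at hcross₂
  have hm := hw₁.1
  have hn := hw₂.1
  -- after `m * n * d` steps the ends of the edge have moved by `w₁ ^ (n * d)` and `w₂ ^ (m * d)`
  have key : ∀ d : ℕ, 0 < d → ∀ u : G.fundGroup x₀,
      (∃ (s : Bool) (M N : List (Ed × Bool)),
        FreeGroup.invRev (a ^ (n * d)).toWord ++ (E, true) :: (b ^ (m * d)).toWord =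
          M ++ (E, s) :: N ∧
        (u : FreeGroup Ed) * T.path (G.src E) * (if s then 1 else FreeGroup.of E) =
          T.path (G.src E) * a ^ (n * d) * FreeGroup.mk M) →
      ∃ t : unitInterval, T.HasRotationElement f F (G.edgePt E t) u (m * n * d) := by
    rintro d hd u ⟨s, M, N, hMN, hu⟩
    have hred := FreeGroup.isReduced_invRev_pow_append_cons_pow ha0 hb0
      (Nat.mul_pos hn hd).ne' (Nat.mul_pos hm hd).ne'
    have hX : ((w₁ ^ (n * d) : G.fundGroup x₀) : FreeGroup Ed) * T.path (G.src E) =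
        T.path (G.src E) * a ^ (n * d) :=
      ((show SemiconjBy (T.path (G.src E)) a w₁ by simp [SemiconjBy, ha, mul_assoc]).pow_right
        _).eq.symm
    have hY : ((w₂ ^ (m * d) : G.fundGroup x₀) : FreeGroup Ed) * T.path (G.tgt E) =
        T.path (G.tgt E) * b ^ (m * d) :=
      ((show SemiconjBy (T.path (G.tgt E)) b w₂ by simp [SemiconjBy, hb, mul_assoc]).pow_right
        _).eq.symm
    refine T.exists_hasRotationElement hF hE (by positivity) u
      (X := w₁ ^ (n * d) • T.liftV (G.src E)) (Y := w₂ ^ (m * d) • T.liftV (G.tgt E)) ?_ ?_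
      (FreeGroup.height_separates (hMN ▸ hred) ?_ (hu.trans ?_))
    · rw [mul_assoc]
      exact hF.iterate_mul hw₁.2.2 _
    · rw [mul_comm m n, mul_assoc]
      exact hF.iterate_mul hw₂.2.2 _
    · change ((w₂ ^ (m * d) : G.fundGroup x₀) : FreeGroup Ed) * T.path (G.tgt E) =
        ((w₁ ^ (n * d) : G.fundGroup x₀) : FreeGroup Ed) * T.path (G.src E) * _
      rw [hX, hY, ← hMN, ← FreeGroup.mul_mk, ← FreeGroup.inv_mk, FreeGroup.mk_toWord,
        ← List.singleton_append, ← FreeGroup.mul_mk, FreeGroup.mk_toWord, T.path_tgt hE]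
      change _ = _ * (_ * (FreeGroup.of E * _))
      group
    · exact congrArg (· * FreeGroup.mk M) hX.symm
  have hnum : ∀ {r : ℚ} {m : ℕ}, 0 < m → 0 < r → r < 1 / m →
      ∃ c : ℕ, (c : ℚ) = r.num ∧ c * m < r.den := by
    intro r m hm hr hrm
    obtain ⟨c, hc⟩ := Int.eq_ofNat_of_zero_le (Rat.num_pos.2 hr).le
    refine ⟨c, by rw [hc]; rfl, ?_⟩
    have hm' : (0 : ℚ) < m := by exact_mod_cast hm
    have hd : (0 : ℚ) < r.den := by exact_mod_cast r.den_pos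
    rw [lt_div_iff₀ hm', ← Rat.num_div_den r, hc, div_mul_eq_mul_div, div_lt_one hd] at hrm
    exact_mod_cast hrm
  refine ⟨γ₁, γ₂, hγ₁, hγ₂, fun r s hr hrm hs hsn => ?_⟩
  obtain ⟨c, hc, hcm⟩ := hnum hm hr hrm
  obtain ⟨c', hc', hcn⟩ := hnum hn hs hsn
  have hm' : (m : ℚ) ≠ 0 := by exact_mod_cast hm.ne'
  have hn' : (n : ℚ) ≠ 0 := by exact_mod_cast hn.ne'
  refine ⟨m * n * c, m * n * r.den, m * n * c', m * n * s.den,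
    Nat.mul_pos (Nat.mul_pos hm hn) r.den_pos, Nat.mul_pos (Nat.mul_pos hm hn) s.den_pos,
    ?_, ?_, key _ r.den_pos _ ?_, key _ s.den_pos _ ?_⟩
  · push_cast
    rw [hc, mul_div_mul_left _ _ (mul_ne_zero hm' hn'), Rat.num_div_den]
  · push_cast
    rw [hc', mul_div_mul_left _ _ (mul_ne_zero hm' hn'), Rat.num_div_den]
  · obtain ⟨s, M, N, hMN, hu⟩ := hcross₁ (m * n * c) (n * r.den) (by nlinarith)
    -- the path is traversed backwards, so the crossing is the inverse letter
    refine ⟨!s, FreeGroup.invRev N, FreeGroup.invRev M ++ (E, true) :: (b ^ (m * r.den)).toWord,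
      ?_, ?_⟩
    · rw [hMN]
      simp [FreeGroup.invRev]
    · have hword : a ^ (n * r.den) = FreeGroup.mk M * FreeGroup.mk [(E, s)] * FreeGroup.mk N := by
        rw [FreeGroup.mul_mk, FreeGroup.mul_mk, List.append_assoc, List.singleton_append, ← hMN,
          FreeGroup.mk_toWord]
      rw [hword, ← FreeGroup.inv_mk, ← mul_assoc, ← mul_assoc, ← hu, mul_inv_cancel_right]
      cases s
      · change _ = _ * (FreeGroup.of E)⁻¹
        simp
      · change _ = _ * FreeGroup.of E
        simp
  · obtain ⟨t, M, N, hMN, hu⟩ := hcross₂ (m * n * c') (m * s.den) (by nlinarith)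
    refine ⟨t, FreeGroup.invRev (a ^ (n * s.den)).toWord ++ (E, true) :: M, N, ?_, ?_⟩
    · rw [hMN]
      simp
    · rw [hu, T.path_tgt hE, ← FreeGroup.mul_mk, ← FreeGroup.inv_mk, FreeGroup.mk_toWord,
        ← List.singleton_append, ← FreeGroup.mul_mk]
      change _ = _ * (_ * (FreeGroup.of E * _))
      group
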